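/- Let $m\ge 1$ be odd and $k\ge 0$, let $\mathbb R_{0,m}$ be the real Clifford algebra generated by the standard basis $e_1,\dots,e_m$ of $\mathbb R^m$ with $e_je_l+e_le_j=-2\delta_{jl}$, and identify $\underline x=(x_1,\dots,x_m)\in\mathbb R^m$ with $\sum_j x_je_j$. Let $\partial_{\underline x}=\sum_{j=1}^m e_j\partial_{x_j}$, $\Delta=\sum_{j=0}^m\partial_{x_j}^2$, $r=|\underline x|$, $\underline\omega=\underline x/r$, and put $N=k+\frac{m-1}{2}$. A $C^1$ function $F:\mathbb R^{m+1}\to\mathbb R_{0,m}$ (resp. $f:\mathbb R^m\to\mathbb R_{0,m}$) is called monogenic if $(\partial_{x_0}+\partial_{\underline x})F=0$ (resp. $\partial_{\underline x}f=0$). Let $P_k:\mathbb R^m\to\mathbb R_{0,m}$ be a homogeneous monogenic polynomial of degree $k$ (with coefficients in $\mathbb R_{0,m}$). Define $$\mathsf{CK}[g](x_0,\underline x)=\sum_{n=0}^\infty\frac{(-x_0)^n}{n!}\,\partial_{\underline x}^n g(\underline x),$$ $$\mathsf{Ft}[u+iv,P_k](x_0,\underline x)=\Delta^{N}\Bigl[\bigl(u(x_0,r)+\underline\omega\,v(x_0,r)\bigr)P_k(\underline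 x)\Bigr],$$ $D_r(j)[f]=(r^{-1}\partial_r)^jf$, $D^r(j)[f]=(\partial_r\,r^{-1})^jf$, and the Clifford–Hermite polynomials $H_{n,m}(P_k)=(2\underline x-\partial_{\underline x})^nP_k$. For $\mathsf{Ft}$ with $u+iv=\exp(z^2)$, the term $\underline\omega\,v(x_0,r)$ is taken to be $0$ at $\underline x=0$ (where $v(x_0,0)=0$). For $g(\underline x)=\exp(-|\underline x|^2)P_k(\underline x)$ the series $\mathsf{CK}[g]$ converges at every point of $\mathbb R^{m+1}$, its sum is monogenic in $\mathbb R^{m+1}$ and equals $g$ for $x_0=0$. Moreover, for all $(x_0,\underline x)\in\mathbb R^{m+1}$, $$\mathsf{CK}\bigl[\exp(-|\underline x|^2)P_k(\underline x)\bigr](x_0,\underline x)=\frac{\mathsf{Ft}\bigl[\exp(z^2),P_k\bigr](x_0,\underline x)}{(-2)^{k+\frac{m-1}{2}}\,(2k+m-1)!!},$$ and, for $\underline x\neq0$, this is equal to $$\exp(x_0^2-r^2)\left(\sum_{j=0}^{N}\binom{N}{j}(-2)^{-j}D_r(j)[\cos(2x_0r)]+\underline\omega\sum_{j=0}^{N}\binom{N}{j}(-2)^{-j}D^r(j)[\sin(2x_0r)]\right)P_k(\underline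 x);$$ as $(x_0',\underline x)\to(x_0,0)$ with $\underline x\ne0$, the last expression (taken at $(x_0',\underline x)$) tends to $\mathsf{CK}[g](x_0,0)$. Finally, $\mathsf{CK}[g]$ generates the Clifford–Hermite polynomials: for all $(x_0,\underline x)\in\mathbb R^{m+1}$, $$\mathsf{CK}[g](x_0,\underline x)=\exp(-|\underline x|^2)\sum_{n=0}^\infty\frac{x_0^n}{n!}\,H_{n,m}(P_k)(\underline x),$$ with a convergent series on the right. -/

import Mathlib

open scoped Nat Topology

noncomputable section

namespace CliffordAnalysis

/-- The Euclidean space `ℝ^m`. -/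
abbrev Vec (m : ℕ) : Type := EuclideanSpace ℝ (Fin m)

/-- The quadratic form `x ↦ -|x|²` on `ℝ^m`. -/
def negNormSq (m : ℕ) : QuadraticForm ℝ (Vec m) :=
  -LinearMap.BilinMap.toQuadraticMap (innerₗ (Vec m))

theorem negNormSq_apply {m : ℕ} (x : Vec m) : negNormSq m x = -‖x‖ ^ 2 := by
  simp [negNormSq]

/-- The real Clifford algebra `ℝ_{0,m}`: generated by `e₁, …, e_m` with
`e_j e_k + e_k e_j = -2 δ_{jk}`. -/
abbrev Cl (m : ℕ) : Type := CliffordAlgebra (negNormSq m)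

/-- A vector `x = ∑ x_j e_j` seen as an element of the Clifford algebra. -/
abbrev vec {m : ℕ} (x : Vec m) : Cl m := CliffordAlgebra.ι (negNormSq m) x

/-- The standard basis vector `e_j` of `ℝ^m`. -/
abbrev basisVec {m : ℕ} (j : Fin m) : Vec m := EuclideanSpace.single j (1 : ℝ)

theorem vec_mul_self {m : ℕ} (x : Vec m) :
    vec x * vec x = algebraMap ℝ (Cl m) (-‖x‖ ^ 2) := by
  rw [CliffordAlgebra.ι_sq_scalar, negNormSq_apply]

theorem basisVec_mul_add_swap {m : ℕ} (j l : Fin m) :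
    vec (basisVec j) * vec (basisVec l) + vec (basisVec l) * vec (basisVec j)
      = algebraMap ℝ (Cl m) (-2 * (if j = l then 1 else 0)) := by
  rw [CliffordAlgebra.ι_mul_ι_add_swap]
  congr 1
  by_cases h : j = l
  · subst h
    simp [negNormSq, QuadraticMap.polar, EuclideanSpace.inner_single_left]
    norm_num
  · have h' : ¬ l = j := fun e => h e.symm
    simp [negNormSq, QuadraticMap.polar, EuclideanSpace.inner_single_left, h, h']

/-- The `2^m` coordinates of an element of the Clifford algebra. -/
def coordEquiv (m : ℕ) : Cl m ≃ₗ[ℝ] EuclideanSpace ℝ (Finset (Fin m)) :=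
  letI : Invertible (2 : ℝ) := invertibleOfNonzero two_ne_zero
  ((CliffordAlgebra.equivExterior (negNormSq m)).trans
    ((EuclideanSpace.basisFun (Fin m) ℝ).toBasis.ExteriorAlgebra.equivFun)).trans
      (WithLp.linearEquiv 2 ℝ (Finset (Fin m) → ℝ)).symm

/-- The Euclidean norm of the coordinates. As the Clifford algebra is finite-dimensional, any
other norm would give the same limits, derivatives and infinite sums. -/
instance instNormedAddCommGroupCl (m : ℕ) : NormedAddCommGroup (Cl m) :=
  NormedAddCommGroup.induced (Cl m) (EuclideanSpace ℝ (Finset (Fin m)))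
    (coordEquiv m).toLinearMap (coordEquiv m).injective

instance instNormedSpaceCl (m : ℕ) : NormedSpace ℝ (Cl m) :=
  NormedSpace.induced ℝ (Cl m) (EuclideanSpace ℝ (Finset (Fin m))) (coordEquiv m).toLinearMap

instance instFiniteDimensionalCl (m : ℕ) : FiniteDimensional ℝ (Cl m) :=
  (coordEquiv m).symm.finiteDimensional

/-- The Dirac operator `∂_x f = ∑_j e_j ∂_{x_j} f` in `ℝ^m`. -/
def dirac {m : ℕ} (f : Vec m → Cl m) (x : Vec m) : Cl m :=
  ∑ j : Fin m, vec (basisVec j) * lineDeriv ℝ f x (basisVec j)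

/-- The partial derivative `∂_{x₀}` in `ℝ^{m+1} = ℝ × ℝ^m`. -/
def pd₀ {m : ℕ} (F : ℝ × Vec m → Cl m) (p : ℝ × Vec m) : Cl m :=
  lineDeriv ℝ F p (1, 0)

/-- The partial derivative `∂_{x_j}`, `1 ≤ j ≤ m`, in `ℝ^{m+1} = ℝ × ℝ^m`. -/
def pd {m : ℕ} (j : Fin m) (F : ℝ × Vec m → Cl m) (p : ℝ × Vec m) : Cl m :=
  lineDeriv ℝ F p (0, basisVec j)

/-- The generalized Cauchy–Riemann operator `∂_{x₀} + ∂_x` in `ℝ^{m+1}`. -/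
def cauchyRiemann {m : ℕ} (F : ℝ × Vec m → Cl m) (p : ℝ × Vec m) : Cl m :=
  pd₀ F p + ∑ j : Fin m, vec (basisVec j) * pd j F p

/-- The Laplacian `Δ = ∑_{j=0}^m ∂_{x_j}²` in `ℝ^{m+1}`. -/
def laplace {m : ℕ} (F : ℝ × Vec m → Cl m) (p : ℝ × Vec m) : Cl m :=
  pd₀ (pd₀ F) p + ∑ j : Fin m, pd j (pd j F) p

/-- Monogenic functions in `ℝ^m`. -/
def IsMonogenic {m : ℕ} (f : Vec m → Cl m) : Prop :=
  ContDiff ℝ 1 f ∧ ∀ x, dirac f x = 0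

/-- Monogenic functions in `ℝ^{m+1}`. -/
def IsMonogenicExt {m : ℕ} (F : ℝ × Vec m → Cl m) : Prop :=
  ContDiff ℝ 1 F ∧ ∀ p, cauchyRiemann F p = 0

/-- `P` is a homogeneous polynomial of degree `k` in `x₁, …, x_m` with coefficients in the
Clifford algebra. -/
def IsHomogeneousPolynomial {m : ℕ} (k : ℕ) (P : Vec m → Cl m) : Prop :=
  ∃ c : (Fin m → ℕ) → Cl m, ∀ x : Vec m,
    P x = ∑ a ∈ Finset.piAntidiag Finset.univ k, (∏ i, x i ^ a i) • c a

/-- The `n`-th term `((-x₀)^n / n!) ∂_x^n g(x)` of the Cauchy–Kowalevski series. -/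
def ckTerm {m : ℕ} (g : Vec m → Cl m) (p : ℝ × Vec m) (n : ℕ) : Cl m :=
  ((-p.1) ^ n / (n ! : ℝ)) • dirac^[n] g p.2

/-- The Cauchy–Kowalevski extension `CK[g](x₀, x) = ∑_n ((-x₀)^n / n!) ∂_x^n g(x)`. -/
def CK {m : ℕ} (g : Vec m → Cl m) (p : ℝ × Vec m) : Cl m :=
  ∑' n : ℕ, ckTerm g p n

/-- The unit vector `ω = x / |x|` (and `0` at `x = 0`). -/
def omega {m : ℕ} (x : Vec m) : Cl m := vec (‖x‖⁻¹ • x)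

/-- For `h = u + i v`, the function `(u(x₀, r) + ω v(x₀, r)) P(x)`, where `r = |x|`. -/
def fueterBase {m : ℕ} (h : ℂ → ℂ) (P : Vec m → Cl m) (p : ℝ × Vec m) : Cl m :=
  (algebraMap ℝ (Cl m) (h ⟨p.1, ‖p.2‖⟩).re + (h ⟨p.1, ‖p.2‖⟩).im • omega p.2) * P p.2

/-- `Ft[h(z), P_k] = Δ^{k + (m-1)/2} [(u(x₀, r) + ω v(x₀, r)) P_k(x)]` (for `m` odd). -/
def Ft {m : ℕ} (k : ℕ) (h : ℂ → ℂ) (P : Vec m → Cl m) : ℝ × Vec m → Cl m :=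
  laplace^[k + (m - 1) / 2] (fueterBase h P)

/-- `D_r(n)[u] = (r⁻¹ ∂_r)^n u`. -/
def lowerD (n : ℕ) (u : ℝ → ℝ) : ℝ → ℝ :=
  (fun f r => r⁻¹ * deriv f r)^[n] u

/-- `D^r(n)[v] = (∂_r r⁻¹)^n v`. -/
def upperD (n : ℕ) (v : ℝ → ℝ) : ℝ → ℝ :=
  (fun f => deriv (fun r => r⁻¹ * f r))^[n] v

/-- The operator `D_+ = 2 x - ∂_x`. -/
def Dplus {m : ℕ} (f : Vec m → Cl m) (x : Vec m) : Cl m :=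
  (2 : ℝ) • (vec x * f x) - dirac f x

/-- The Clifford–Hermite polynomial `H_{n,m}(P) = D_+^n P`. -/
def cliffordHermite {m : ℕ} (n : ℕ) (P : Vec m → Cl m) : Vec m → Cl m :=
  Dplus^[n] P

/-- `∑_{j=0}^N C(N,j) (-2)^{-j} D_r(j)[cos(2 x₀ r)]`. -/
def cosPart (N : ℕ) (x₀ r : ℝ) : ℝ :=
  ∑ j ∈ Finset.range (N + 1), (N.choose j : ℝ) * (-2 : ℝ) ^ (-(j : ℤ)) *
    lowerD j (fun s => Real.cos (2 * x₀ * s)) r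

/-- `∑_{j=0}^N C(N,j) (-2)^{-j} D^r(j)[sin(2 x₀ r)]`. -/
def sinPart (N : ℕ) (x₀ r : ℝ) : ℝ :=
  ∑ j ∈ Finset.range (N + 1), (N.choose j : ℝ) * (-2 : ℝ) ^ (-(j : ℤ)) *
    upperD j (fun s => Real.sin (2 * x₀ * s)) r

/-- The closed form `exp(x₀² - r²) (cosPart + ω sinPart) P(x)`, meaningful for `r = |x| > 0`. -/
def closedForm {m : ℕ} (N : ℕ) (P : Vec m → Cl m) (p : ℝ × Vec m) : Cl m :=
  Real.exp (p.1 ^ 2 - ‖p.2‖ ^ 2) •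
    ((algebraMap ℝ (Cl m) (cosPart N p.1 ‖p.2‖) + sinPart N p.1 ‖p.2‖ • omega p.2) * P p.2)

end CliffordAnalysis

end

open scoped Nat Topology ContDiff

noncomputable section

namespace CliffordAnalysis

/-! Everything reduces to axial functions `(A(x₀, t) + x B(x₀, t)) P(x)` with `t = |x|²` and `A`,
`B` entire. For `P` monogenic of degree `k` and `m + 2k = 2N + 1`, such a function is monogenic if
`(A, B)` solves the system `IsVekuaPair N`. For index `0` this system is the Cauchy–Riemann system
in `(x₀, √t)` with `u = A`, `v = √t B`, so `exp (z²)` provides a solution (`isVekuaPair_gauss`).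

Two facts give Fueter's theorem: `∂ₜ` raises the index by one (`cd₂_pair`), and on pairs of index
`n` the Laplacian acts as `4 (N - n) ∂ₜ` (`laplace_axial`). Hence `Δ^N` acts as `4^N N! ∂ₜ^N` and
produces a monogenic function. At `x₀ = 0` one has `∂ₜ^N exp (-t) = (-1)^N exp (-t)`, so after
division by `(-1)^N 4^N N! = (-2)^N (2N)!!` the restriction is exactly `g`.

On monogenic functions `∂_x = -∂_{x₀}`, so the CK series is the Taylor series in `x₀` of entire
functions and converges everywhere (`hasSum_ckTerm_axial`). The closed form is the Leibniz rule for
`∂ₜ^N` of `exp (x₀² - t)` times a trigonometric factor, with `r⁻¹ ∂_r = 2 ∂ₜ`. The Hermite series is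
the CK series rewritten through `∂_x (e^{-|x|²} f) = -e^{-|x|²} D₊ f`. -/

theorem two_le_infty : (2 : WithTop ℕ∞) ≤ ∞ := WithTop.coe_le_coe.2 le_top

/-! ### Pairs of functions of two complex variables -/

/-- The complex partial derivative in the first variable. -/
def cd₁ (A : ℂ × ℂ → ℂ) (p : ℂ × ℂ) : ℂ := fderiv ℂ A p (1, 0)

/-- The complex partial derivative in the second variable. -/
def cd₂ (A : ℂ × ℂ → ℂ) (p : ℂ × ℂ) : ℂ := fderiv ℂ A p (0, 1)

section Partials

variable {A B : ℂ × ℂ → ℂ}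

theorem contDiff_cd₁ (hA : ContDiff ℂ ∞ A) : ContDiff ℂ ∞ (cd₁ A) :=
  (hA.fderiv_right (by simp)).clm_apply contDiff_const

theorem contDiff_cd₂ (hA : ContDiff ℂ ∞ A) : ContDiff ℂ ∞ (cd₂ A) :=
  (hA.fderiv_right (by simp)).clm_apply contDiff_const

theorem contDiff_iterate_cd₁ (hA : ContDiff ℂ ∞ A) (n : ℕ) : ContDiff ℂ ∞ (cd₁^[n] A) := by
  induction n with
  | zero => exact hA
  | succ n ih => rw [Function.iterate_succ_apply']; exact contDiff_cd₁ ih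

theorem contDiff_iterate_cd₂ (hA : ContDiff ℂ ∞ A) (n : ℕ) : ContDiff ℂ ∞ (cd₂^[n] A) := by
  induction n with
  | zero => exact hA
  | succ n ih => rw [Function.iterate_succ_apply']; exact contDiff_cd₂ ih

theorem differentiable_of_contDiff {E F : Type*} [NormedAddCommGroup E] [NormedSpace ℝ E]
    [NormedAddCommGroup F] [NormedSpace ℝ F] {f : E → F} (hf : ContDiff ℝ ∞ f) :
    Differentiable ℝ f :=
  hf.differentiable (by simp)

theorem cd₁_cd₂ (hA : ContDiff ℂ ∞ A) : cd₁ (cd₂ A) = cd₂ (cd₁ A) := by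
  funext p
  have hs : IsSymmSndFDerivAt ℂ A p :=
    hA.contDiffAt.isSymmSndFDerivAt (by simpa using two_le_infty)
  have hd : DifferentiableAt ℂ (fderiv ℂ A) p :=
    ((hA.fderiv_right (m := ∞) (by simp)).differentiable (by simp)) p
  have key : ∀ v w : ℂ × ℂ, fderiv ℂ (fun q => fderiv ℂ A q v) p w
      = fderiv ℂ (fderiv ℂ A) p w v := by
    intro v w
    rw [fderiv_clm_apply hd (differentiableAt_const v)]
    simp
  have h1 := key (0, 1) (1, 0)
  have h2 := key (1, 0) (0, 1)
  change fderiv ℂ (fun q => fderiv ℂ A q (0, 1)) p (1, 0)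
    = fderiv ℂ (fun q => fderiv ℂ A q (1, 0)) p (0, 1)
  rw [h1, h2, hs.eq]

theorem hasDerivAt_fst (hA : ContDiff ℂ ∞ A) (z t : ℂ) :
    HasDerivAt (fun w => A (w, t)) (cd₁ A (z, t)) z := by
  have h := ((hA.differentiable (by simp)) (z, t)).hasFDerivAt
  exact h.comp_hasDerivAt z ((hasDerivAt_id z).prodMk (hasDerivAt_const z t))

theorem hasDerivAt_snd (hA : ContDiff ℂ ∞ A) (z t : ℂ) :
    HasDerivAt (fun w => A (z, w)) (cd₂ A (z, t)) t := by
  have h := ((hA.differentiable (by simp)) (z, t)).hasFDerivAt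
  exact h.comp_hasDerivAt t ((hasDerivAt_const t z).prodMk (hasDerivAt_id t))

theorem iterate_cd₁_eq_iteratedDeriv (hA : ContDiff ℂ ∞ A) (n : ℕ) (z t : ℂ) :
    cd₁^[n] A (z, t) = iteratedDeriv n (fun w => A (w, t)) z := by
  induction n generalizing z with
  | zero => simp
  | succ n ih =>
    rw [Function.iterate_succ_apply', iteratedDeriv_succ, ← funext ih]
    exact (hasDerivAt_fst (contDiff_iterate_cd₁ hA n) z t).deriv.symm

theorem iterate_cd₂_eq_iteratedDeriv (hA : ContDiff ℂ ∞ A) (n : ℕ) (z t : ℂ) :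
    cd₂^[n] A (z, t) = iteratedDeriv n (fun w => A (z, w)) t := by
  induction n generalizing t with
  | zero => simp
  | succ n ih =>
    rw [Function.iterate_succ_apply', iteratedDeriv_succ, ← funext ih]
    exact (hasDerivAt_snd (contDiff_iterate_cd₂ hA n) z t).deriv.symm

theorem cd₁_const_mul (hA : ContDiff ℂ ∞ A) (c : ℂ) :
    cd₁ (fun p => c * A p) = fun p => c * cd₁ A p := by
  funext p
  exact (((hasDerivAt_fst (contDiff_const.mul hA) p.1 p.2).unique
    ((hasDerivAt_fst hA p.1 p.2).const_mul c)))

theorem cd₂_const_mul (hA : ContDiff ℂ ∞ A) (c : ℂ) :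
    cd₂ (fun p => c * A p) = fun p => c * cd₂ A p := by
  funext p
  exact (((hasDerivAt_snd (contDiff_const.mul hA) p.1 p.2).unique
    ((hasDerivAt_snd hA p.1 p.2).const_mul c)))

/-- The Taylor expansion in the first variable converges everywhere. -/
theorem hasSum_iterate_cd₁ (hA : ContDiff ℂ ∞ A) (z t : ℂ) :
    HasSum (fun n : ℕ => (n ! : ℂ)⁻¹ * z ^ n * cd₁^[n] A (0, t)) (A (z, t)) := by
  have h := Complex.hasSum_taylorSeries_of_entire (f := fun w => A (w, t))
    (fun w => (hasDerivAt_fst hA w t).differentiableAt) 0 z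
  simpa [iterate_cd₁_eq_iteratedDeriv hA, mul_assoc] using h

/-! ### The Vekua system and its stability under differentiation -/

/-- The system `∂₁ A = (2 n + 1) B + 2 s ∂ₛ B`, `∂₁ B = -2 ∂ₛ A`. It says that
`(A(x₀, |x|²) + x B(x₀, |x|²)) P(x)` is annihilated by the Cauchy–Riemann operator if `P` is
monogenic and homogeneous of degree `k` with `2 k + m = 2 n + 1`. -/
structure IsVekuaPair (n : ℕ) (A B : ℂ × ℂ → ℂ) : Prop where
  contDiff_left : ContDiff ℂ ∞ A
  contDiff_right : ContDiff ℂ ∞ B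
  cd₁_left : ∀ p, cd₁ A p = (2 * n + 1) * B p + 2 * p.2 * cd₂ B p
  cd₁_right : ∀ p, cd₁ B p = -2 * cd₂ A p

namespace IsVekuaPair

variable {n : ℕ}

theorem cd₂_cd₁_left (h : IsVekuaPair n A B) (p : ℂ × ℂ) :
    cd₂ (cd₁ A) p = (2 * n + 3) * cd₂ B p + 2 * p.2 * cd₂ (cd₂ B) p := by
  have h1 := hasDerivAt_snd (contDiff_cd₁ h.contDiff_left) p.1 p.2
  have h2 := ((hasDerivAt_snd h.contDiff_right p.1 p.2).const_mul (2 * (n : ℂ) + 1)).add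
    (((hasDerivAt_id p.2).const_mul 2).mul (hasDerivAt_snd (contDiff_cd₂ h.contDiff_right) p.1 p.2))
  have h3 := h1.unique (h2.congr_of_eventuallyEq
    (Filter.Eventually.of_forall fun w => h.cd₁_left (p.1, w)))
  refine h3.trans ?_
  simp only [id, Prod.mk.eta]
  ring

theorem cd₂_cd₁_right (h : IsVekuaPair n A B) (p : ℂ × ℂ) :
    cd₂ (cd₁ B) p = -2 * cd₂ (cd₂ A) p := by
  rw [funext h.cd₁_right, cd₂_const_mul (contDiff_cd₂ h.contDiff_left)]

theorem cd₁_cd₁_left (h : IsVekuaPair n A B) (p : ℂ × ℂ) :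
    cd₁ (cd₁ A) p = (2 * n + 1) * cd₁ B p + 2 * p.2 * cd₂ (cd₁ B) p := by
  have h1 := hasDerivAt_fst (contDiff_cd₁ h.contDiff_left) p.1 p.2
  have h2 := ((hasDerivAt_fst h.contDiff_right p.1 p.2).const_mul (2 * (n : ℂ) + 1)).add
    ((hasDerivAt_fst (contDiff_cd₂ h.contDiff_right) p.1 p.2).const_mul (2 * p.2))
  have h3 := h1.unique (h2.congr_of_eventuallyEq
    (Filter.Eventually.of_forall fun w => h.cd₁_left (w, p.2)))
  rw [cd₁_cd₂ h.contDiff_right] at h3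
  exact h3

/-- The coefficients of the system do not involve the first variable, so the index is unchanged. -/
theorem cd₁_pair (h : IsVekuaPair n A B) : IsVekuaPair n (cd₁ A) (cd₁ B) where
  contDiff_left := contDiff_cd₁ h.contDiff_left
  contDiff_right := contDiff_cd₁ h.contDiff_right
  cd₁_left := h.cd₁_cd₁_left
  cd₁_right p := by
    rw [funext h.cd₁_right, cd₁_const_mul (contDiff_cd₂ h.contDiff_left),
      cd₁_cd₂ h.contDiff_left]

/-- Differentiating the factor `2 t` in `2 t ∂ₜ B` yields an extra `2 ∂ₜ B`, which turns `2n + 1`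
into `2(n + 1) + 1`. -/
theorem cd₂_pair (h : IsVekuaPair n A B) : IsVekuaPair (n + 1) (cd₂ A) (cd₂ B) where
  contDiff_left := contDiff_cd₂ h.contDiff_left
  contDiff_right := contDiff_cd₂ h.contDiff_right
  cd₁_left p := by
    rw [cd₁_cd₂ h.contDiff_left, h.cd₂_cd₁_left]
    push_cast
    ring
  cd₁_right p := by rw [cd₁_cd₂ h.contDiff_right, h.cd₂_cd₁_right]

theorem const_mul (h : IsVekuaPair n A B) (c : ℂ) :
    IsVekuaPair n (fun p => c * A p) (fun p => c * B p) where
  contDiff_left := contDiff_const.mul h.contDiff_left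
  contDiff_right := contDiff_const.mul h.contDiff_right
  cd₁_left p := by
    rw [cd₁_const_mul h.contDiff_left, cd₂_const_mul h.contDiff_right]
    simp only [h.cd₁_left]
    ring
  cd₁_right p := by
    rw [cd₁_const_mul h.contDiff_right, cd₂_const_mul h.contDiff_left]
    simp only [h.cd₁_right]
    ring

theorem iterate_cd₂ (h : IsVekuaPair 0 A B) (j : ℕ) :
    IsVekuaPair j (cd₂^[j] A) (cd₂^[j] B) := by
  induction j with
  | zero => exact h
  | succ j ih => simpa only [Function.iterate_succ_apply'] using ih.cd₂_pair

end IsVekuaPair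

end Partials

/-! ### The entire functions `cos √t` and `sin √t / √t` -/

/-- The entire function `cos √t`. -/
def cosSqrt (t : ℂ) : ℂ := ∑' n : ℕ, (-1) ^ n * t ^ n / ((2 * n)! : ℂ)

/-- The entire function `sin √t / √t`. -/
def sincSqrt (t : ℂ) : ℂ := -2 * deriv cosSqrt t

theorem cosSqrt_sq (z : ℂ) : cosSqrt (z ^ 2) = Complex.cos z := by
  rw [← (Complex.hasSum_cos z).tsum_eq, cosSqrt]
  simp only [pow_mul]

/-- Weierstrass M-test on a ball of radius `‖z‖ + 1`; bounding `(2n)!` below by `n!` makes the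
exponential series a majorant. -/
theorem differentiable_cosSqrt : Differentiable ℂ cosSqrt := by
  intro z
  have h := Complex.differentiableOn_tsum_of_summable_norm
    (F := fun (n : ℕ) (t : ℂ) => (-1) ^ n * t ^ n / ((2 * n)! : ℂ))
    (Real.summable_pow_div_factorial (‖z‖ + 1))
    (fun n => by fun_prop) (Metric.isOpen_ball (x := (0 : ℂ)) (ε := ‖z‖ + 1)) (by
      intro n w hw
      have hw' : ‖w‖ ≤ ‖z‖ + 1 := (mem_ball_zero_iff.1 hw).le
      have hf : (n ! : ℝ) ≤ ((2 * n)! : ℕ) := by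
        exact_mod_cast Nat.factorial_le (by omega)
      simp only [norm_div, norm_mul, norm_pow, norm_neg, norm_one, one_pow, one_mul,
        Complex.norm_natCast]
      gcongr)
  exact h.differentiableAt (Metric.isOpen_ball.mem_nhds (by simp))

theorem contDiff_cosSqrt : ContDiff ℂ ∞ cosSqrt := differentiable_cosSqrt.contDiff

theorem contDiff_sincSqrt : ContDiff ℂ ∞ sincSqrt :=
  contDiff_const.mul ((contDiff_infty_iff_deriv.1 contDiff_cosSqrt).2)

theorem hasDerivAt_cosSqrt (t : ℂ) : HasDerivAt cosSqrt (-(sincSqrt t) / 2) t := by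
  have h := (differentiable_cosSqrt t).hasDerivAt
  exact h.congr_deriv (by simp only [sincSqrt]; ring)

theorem mul_sincSqrt_sq (z : ℂ) : z * sincSqrt (z ^ 2) = Complex.sin z := by
  have h1 := (hasDerivAt_cosSqrt (z ^ 2)).comp z (hasDerivAt_pow 2 z)
  have h2 := h1.unique ((Complex.hasDerivAt_cos z).congr_of_eventuallyEq
    (Filter.Eventually.of_forall cosSqrt_sq))
  simp only [Nat.cast_ofNat, Nat.add_one_sub_one, pow_one] at h2
  linear_combination -h2

/-- Obtained by differentiating `z sincSqrt (z²) = sin z` at a complex square root `z` of `t`; no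
division by `z` occurs, so `t = 0` is included. -/
theorem cosSqrt_eq (t : ℂ) : cosSqrt t = sincSqrt t + 2 * t * deriv sincSqrt t := by
  obtain ⟨z, rfl⟩ := IsAlgClosed.exists_pow_nat_eq t (n := 2) two_pos
  have hd : HasDerivAt sincSqrt (deriv sincSqrt (z ^ 2)) (z ^ 2) :=
    ((contDiff_sincSqrt.differentiable (by simp)) _).hasDerivAt
  have h1 := (hasDerivAt_id z).mul (hd.comp z (hasDerivAt_pow 2 z))
  have h2 := h1.unique ((Complex.hasDerivAt_sin z).congr_of_eventuallyEq
    (Filter.Eventually.of_forall mul_sincSqrt_sq))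
  simp only [Nat.cast_ofNat, Nat.add_one_sub_one, pow_one, id, Function.comp] at h2
  rw [cosSqrt_sq]
  linear_combination -h2

theorem cosSqrt_zero : cosSqrt 0 = 1 := by simpa using cosSqrt_sq 0

/-! ### The pair attached to `exp (z²)` -/

/-- `cos (2 z √t)`. -/
def cosFactor (p : ℂ × ℂ) : ℂ := cosSqrt (4 * p.1 ^ 2 * p.2)

/-- `sin (2 z √t) / √t`. -/
def sincFactor (p : ℂ × ℂ) : ℂ := 2 * p.1 * sincSqrt (4 * p.1 ^ 2 * p.2)

/-- The real part of `exp ((z + i √t)²)`. -/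
def gaussRe (p : ℂ × ℂ) : ℂ := Complex.exp (p.1 ^ 2 - p.2) * cosFactor p

/-- The imaginary part of `exp ((z + i √t)²)`, divided by `√t`. -/
def gaussIm (p : ℂ × ℂ) : ℂ := Complex.exp (p.1 ^ 2 - p.2) * sincFactor p

theorem contDiff_cosFactor : ContDiff ℂ ∞ cosFactor :=
  contDiff_cosSqrt.comp (by fun_prop)

theorem contDiff_sincFactor : ContDiff ℂ ∞ sincFactor :=
  (by fun_prop : ContDiff ℂ ∞ fun p : ℂ × ℂ => 2 * p.1).mul
    (contDiff_sincSqrt.comp (by fun_prop))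

theorem contDiff_gaussRe : ContDiff ℂ ∞ gaussRe :=
  (by fun_prop : ContDiff ℂ ∞ fun p : ℂ × ℂ => Complex.exp (p.1 ^ 2 - p.2)).mul contDiff_cosFactor

theorem contDiff_gaussIm : ContDiff ℂ ∞ gaussIm :=
  (by fun_prop : ContDiff ℂ ∞ fun p : ℂ × ℂ => Complex.exp (p.1 ^ 2 - p.2)).mul
    contDiff_sincFactor

theorem hasDerivAt_exp_fst (z t : ℂ) : HasDerivAt (fun w => Complex.exp (w ^ 2 - t))
    (Complex.exp (z ^ 2 - t) * (2 * z)) z := by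
  simpa using ((hasDerivAt_pow 2 z).sub_const t).cexp

theorem hasDerivAt_exp_snd (z t : ℂ) : HasDerivAt (fun w => Complex.exp (z ^ 2 - w))
    (Complex.exp (z ^ 2 - t) * (-1)) t := by
  simpa using ((hasDerivAt_id t).const_sub (z ^ 2)).cexp

theorem hasDerivAt_arg_fst (z t : ℂ) : HasDerivAt (fun w => 4 * w ^ 2 * t) (8 * z * t) z := by
  refine (((hasDerivAt_pow 2 z).const_mul 4).mul_const t).congr_deriv ?_
  push_cast
  ring

theorem hasDerivAt_arg_snd (z t : ℂ) : HasDerivAt (fun w => 4 * z ^ 2 * w) (4 * z ^ 2) t := by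
  simpa using (hasDerivAt_id t).const_mul (4 * z ^ 2)

theorem hasDerivAt_sincSqrt (t : ℂ) : HasDerivAt sincSqrt (deriv sincSqrt t) t :=
  ((contDiff_sincSqrt.differentiable (by simp)) _).hasDerivAt

/-- With `v = r B` and `∂_r = 2 r ∂ₜ`, the equations `u_z = v_r` and `v_z = -u_r` become the system
of index `0`. Both are checked by direct differentiation, `cosSqrt_eq` relating the cosine factor to
the derivative of `sincSqrt`. -/
theorem isVekuaPair_gauss : IsVekuaPair 0 gaussRe gaussIm where
  contDiff_left := contDiff_gaussRe
  contDiff_right := contDiff_gaussIm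
  cd₁_left := by
    rintro ⟨z, t⟩
    have h1 := (hasDerivAt_fst contDiff_gaussRe z t).unique ((hasDerivAt_exp_fst z t).mul
      ((hasDerivAt_cosSqrt _).comp z (hasDerivAt_arg_fst z t)))
    have h2 := (hasDerivAt_snd contDiff_gaussIm z t).unique ((hasDerivAt_exp_snd z t).mul
      (((hasDerivAt_sincSqrt _).comp t (hasDerivAt_arg_snd z t)).const_mul (2 * z)))
    have h3 := cosSqrt_eq (4 * z ^ 2 * t)
    simp only [cosFactor, sincFactor] at h1 h2
    rw [h1, h2, h3]
    simp only [gaussIm, sincFactor]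
    push_cast
    ring
  cd₁_right := by
    rintro ⟨z, t⟩
    have h1 := (hasDerivAt_fst contDiff_gaussIm z t).unique ((hasDerivAt_exp_fst z t).mul
      (((hasDerivAt_id z).const_mul 2).mul
        ((hasDerivAt_sincSqrt _).comp z (hasDerivAt_arg_fst z t))))
    have h2 := (hasDerivAt_snd contDiff_gaussRe z t).unique ((hasDerivAt_exp_snd z t).mul
      ((hasDerivAt_cosSqrt _).comp t (hasDerivAt_arg_snd z t)))
    have h3 := cosSqrt_eq (4 * z ^ 2 * t)
    simp only [id, cosFactor, sincFactor] at h1 h2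
    rw [h1, h2, h3]
    ring

/-- The Leibniz rule for a product with `exp (a - t)`. -/
theorem iteratedDeriv_exp_const_sub_mul (a : ℂ) {f : ℂ → ℂ} (hf : ContDiff ℂ ∞ f) (n : ℕ)
    (t : ℂ) : iteratedDeriv n (fun w => Complex.exp (a - w) * f w) t = Complex.exp (a - t) *
      ((-1) ^ n * ∑ j ∈ Finset.range (n + 1), (n.choose j : ℂ) * (-1) ^ j *
        iteratedDeriv j f t) := by
  rw [iteratedDeriv_fun_mul (by fun_prop) (hf.of_le (by exact_mod_cast le_top)).contDiffAt,
    -- Reflection makes `j` count the derivatives falling on `f` instead of those on the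
    -- exponential.
    ← Finset.sum_range_reflect]
  simp only [Finset.mul_sum]
  refine Finset.sum_congr rfl fun j hj => ?_
  have hj' : j ≤ n := by simpa [Nat.lt_succ_iff] using hj
  have hE : iteratedDeriv (n - j) (fun w => Complex.exp (a - w)) t
      = (-1) ^ (n - j) * Complex.exp (a - t) := by
    have := congrFun (iteratedDeriv_comp_const_sub (n - j) Complex.exp a) t
    simpa [iteratedDeriv_eq_iterate, Complex.iter_deriv_exp] using this
  have e1 : n + 1 - 1 - j = n - j := by omega
  have e2 : n - (n - j) = j := by omega
  have hs : ((-1 : ℂ)) ^ n * (-1) ^ j = (-1) ^ (n - j) := by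
    obtain ⟨i, rfl⟩ := Nat.exists_eq_add_of_le hj'
    rw [Nat.add_sub_cancel_left, pow_add, mul_right_comm, ← pow_add, ← two_mul, pow_mul]
    simp
  rw [e1, e2, hE, Nat.choose_symm hj', ← hs]
  ring

/-- The `n`-th second partial of `exp (z² - t) A`, up to sign. -/
theorem iterate_cd₂_exp_mul {A : ℂ × ℂ → ℂ} (hA : ContDiff ℂ ∞ A) (n : ℕ) (p : ℂ × ℂ) :
    (-1) ^ n * cd₂^[n] (fun q => Complex.exp (q.1 ^ 2 - q.2) * A q) p =
      Complex.exp (p.1 ^ 2 - p.2) * ∑ j ∈ Finset.range (n + 1), (n.choose j : ℂ) * (-1) ^ j *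
        cd₂^[j] A p := by
  obtain ⟨z, t⟩ := p
  have hA' : ContDiff ℂ ∞ fun w => A (z, w) := hA.comp (by fun_prop)
  rw [iterate_cd₂_eq_iteratedDeriv
    ((by fun_prop : ContDiff ℂ ∞ fun p : ℂ × ℂ => Complex.exp (p.1 ^ 2 - p.2)).mul hA),
    show (fun w => Complex.exp ((z, w).1 ^ 2 - (z, w).2) * A (z, w))
      = fun w => Complex.exp (z ^ 2 - w) * A (z, w) from rfl,
    iteratedDeriv_exp_const_sub_mul _ hA']
  simp only [iterate_cd₂_eq_iteratedDeriv hA]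
  have hs : ((-1 : ℂ)) ^ n * (-1) ^ n = 1 := by rw [← mul_pow]; simp
  linear_combination (Complex.exp (z ^ 2 - t) * ∑ j ∈ Finset.range (n + 1),
    (n.choose j : ℂ) * (-1) ^ j * iteratedDeriv j (fun w => A (z, w)) t) * hs

/-! ### The Dirac operator -/

section Dirac

variable {m : ℕ}

/-- The multiplication of the Clifford algebra as a continuous bilinear map. -/
def clMul (m : ℕ) : Cl m →L[ℝ] Cl m →L[ℝ] Cl m :=
  (LinearMap.mul ℝ (Cl m)).toContinuousBilinearMap

/-- The embedding of vectors as a continuous linear map. -/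
def vecL (m : ℕ) : Vec m →L[ℝ] Cl m :=
  (CliffordAlgebra.ι (negNormSq m)).toContinuousLinearMap

theorem clMul_apply (a b : Cl m) : clMul m a b = a * b := rfl

theorem vecL_apply (x : Vec m) : vecL m x = vec x := rfl

theorem contDiff_vec_mul {f : Vec m → Cl m} (hf : ContDiff ℝ ∞ f) :
    ContDiff ℝ ∞ fun x => vec x * f x :=
  ((clMul m).contDiff.comp (vecL m).contDiff).clm_apply hf

theorem sum_smul_basisVec (x : Vec m) : ∑ j, x j • (basisVec j : Vec m) = x := by
  ext i
  simp [Finset.sum_apply, Pi.single_apply]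

theorem sum_smul_vec_basisVec (x : Vec m) : ∑ j, x j • vec (basisVec j) = vec x := by
  conv_rhs => rw [← sum_smul_basisVec x]
  simp only [vec, map_sum, map_smul]

theorem basisVec_mul_self (j : Fin m) : vec (basisVec j : Vec m) * vec (basisVec j) = -1 := by
  rw [vec_mul_self]
  simp

theorem basisVec_mul_vec (j : Fin m) (x : Vec m) :
    vec (basisVec j) * vec x = -(vec x * vec (basisVec j)) - (2 * x j) • (1 : Cl m) := by
  have h := CliffordAlgebra.ι_mul_ι_add_swap (Q := negNormSq m) (basisVec j) x
  have h2 : QuadraticMap.polar (negNormSq m) (basisVec j) x = -(2 * x j) := by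
    simp only [QuadraticMap.polar, negNormSq_apply, norm_add_sq_real]
    simp [EuclideanSpace.inner_single_left]
    ring
  rw [h2, Algebra.algebraMap_eq_smul_one, neg_smul] at h
  rw [← sub_eq_iff_eq_add'.2 (h.symm)]
  abel

theorem dirac_eq_sum_fderiv {f : Vec m → Cl m} {x : Vec m} (hf : DifferentiableAt ℝ f x) :
    dirac f x = ∑ j, vec (basisVec j) * fderiv ℝ f x (basisVec j) := by
  simp only [dirac, hf.lineDeriv_eq_fderiv]

theorem contDiff_dirac {f : Vec m → Cl m} (hf : ContDiff ℝ ∞ f) : ContDiff ℝ ∞ (dirac f) := by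
  have h : dirac f = fun x => ∑ j, clMul m (vec (basisVec j)) (fderiv ℝ f x (basisVec j)) := by
    funext x
    exact dirac_eq_sum_fderiv (differentiable_of_contDiff hf x)
  rw [h]
  exact ContDiff.sum fun j _ => (clMul m (vec (basisVec j))).contDiff.comp
    ((hf.fderiv_right (by simp)).clm_apply contDiff_const)

theorem dirac_add {f g : Vec m → Cl m} {x : Vec m} (hf : DifferentiableAt ℝ f x)
    (hg : DifferentiableAt ℝ g x) : dirac (fun y => f y + g y) x = dirac f x + dirac g x := by
  rw [dirac_eq_sum_fderiv hf, dirac_eq_sum_fderiv hg, dirac_eq_sum_fderiv (hf.fun_add hg),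
    fderiv_fun_add hf hg, ← Finset.sum_add_distrib]
  simp only [add_apply, mul_add]

/-- The product rule for a radial function times a Clifford-valued function. -/
theorem dirac_radial_smul {a : ℝ → ℝ} {a' : ℝ} {f : Vec m → Cl m} {x : Vec m}
    (ha : HasDerivAt a a' (‖x‖ ^ 2)) (hf : DifferentiableAt ℝ f x) :
    dirac (fun y => a (‖y‖ ^ 2) • f y) x
      = (2 * a') • (vec x * f x) + a (‖x‖ ^ 2) • dirac f x := by
  have h1 : HasFDerivAt (fun y : Vec m => a (‖y‖ ^ 2)) (a' • (2 • innerSL ℝ x)) x :=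
    ha.comp_hasFDerivAt x (hasStrictFDerivAt_norm_sq x).hasFDerivAt
  have h2 : HasFDerivAt (fun y => a (‖y‖ ^ 2) • f y) _ x := h1.smul hf.hasFDerivAt
  rw [dirac_eq_sum_fderiv h2.differentiableAt, dirac_eq_sum_fderiv hf, h2.fderiv,
    ← sum_smul_vec_basisVec x, Finset.sum_mul, Finset.smul_sum, Finset.smul_sum,
    ← Finset.sum_add_distrib]
  refine Finset.sum_congr rfl fun j _ => ?_
  simp only [add_apply, smul_apply,
    ContinuousLinearMap.smulRight_apply, mul_add, mul_smul_comm, smul_mul_assoc,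
    innerSL_apply_apply, EuclideanSpace.inner_single_right, smul_eq_mul, nsmul_eq_mul, smul_smul]
  rw [add_comm]
  congr 2
  simp
  ring

/-- `∂_x (x f) = -m f - 2 E f - x ∂_x f`, where `E` is the Euler operator. -/
theorem dirac_vec_mul {f : Vec m → Cl m} {x : Vec m} (hf : DifferentiableAt ℝ f x) :
    dirac (fun y => vec y * f y) x
      = -((m : ℝ) • f x) - (2 : ℝ) • fderiv ℝ f x x - vec x * dirac f x := by
  have h1 : HasFDerivAt (fun y => clMul m (vecL m y)) ((clMul m).comp (vecL m)) x :=
    ((clMul m).comp (vecL m)).hasFDerivAt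
  have h2 := h1.clm_apply hf.hasFDerivAt
  have h3 : HasFDerivAt (fun y => vec y * f y) _ x := h2
  rw [dirac_eq_sum_fderiv h3.differentiableAt, dirac_eq_sum_fderiv hf, h3.fderiv]
  have h4 : ∀ j : Fin m, vec (basisVec j) * ((clMul m (vecL m x)).comp (fderiv ℝ f x) +
      ((clMul m).comp (vecL m)).flip (f x)) (basisVec j)
      = -(vec x * (vec (basisVec j) * fderiv ℝ f x (basisVec j)))
        - (2 : ℝ) • fderiv ℝ f x (x j • basisVec j) - f x := by
    intro j
    simp only [add_apply, ContinuousLinearMap.comp_apply,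
      ContinuousLinearMap.flip_apply, clMul_apply, vecL_apply, mul_add, map_smul]
    rw [← mul_assoc, ← mul_assoc (vec (basisVec j)), basisVec_mul_self, basisVec_mul_vec, sub_mul,
      neg_mul, mul_assoc, smul_mul_assoc, one_mul, neg_one_mul, mul_smul]
    abel
  simp only [h4, Finset.sum_sub_distrib, Finset.sum_neg_distrib, ← Finset.mul_sum,
    ← Finset.smul_sum, ← map_sum, sum_smul_basisVec]
  simp only [Finset.sum_const, Finset.card_univ, Fintype.card_fin, Nat.cast_smul_eq_nsmul]
  abel

/-- Against a symmetric array only the symmetric part `-δ_{ij}` of `e_i e_j` survives. Applied to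
second derivatives, this gives `∂_x² = -Δ` on `ℝ^m`. -/
theorem sum_sum_basisVec_mul (S : Fin m → Fin m → Cl m) (hS : ∀ i j, S i j = S j i) :
    ∑ i, ∑ j, vec (basisVec i) * (vec (basisVec j) * S i j) = -∑ j, S j j := by
  have h1 : ∑ i, ∑ j, vec (basisVec i) * (vec (basisVec j) * S i j)
      = ∑ i, ∑ j, vec (basisVec j) * (vec (basisVec i) * S i j) := by
    rw [Finset.sum_comm]
    simp only [hS]
  have h2 : ∑ i, ∑ j, vec (basisVec i) * (vec (basisVec j) * S i j)
      + ∑ i, ∑ j, vec (basisVec j) * (vec (basisVec i) * S i j) = (-2 : ℝ) • ∑ j, S j j := by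
    simp only [← Finset.sum_add_distrib, ← mul_assoc, ← add_mul, basisVec_mul_add_swap]
    simp [Algebra.algebraMap_eq_smul_one, Finset.smul_sum]
  rw [← h1, ← two_smul ℝ] at h2
  have h3 := congrArg (fun a => (2 : ℝ)⁻¹ • a) h2
  simpa [smul_smul] using h3

/-- The square of the Dirac operator is minus the Laplacian. -/
theorem dirac_dirac {f : Vec m → Cl m} (hf : ContDiff ℝ ∞ f) (x : Vec m) :
    dirac (dirac f) x
      = -∑ j, lineDeriv ℝ (fun y => lineDeriv ℝ f y (basisVec j)) x (basisVec j) := by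
  have hd := differentiable_of_contDiff hf
  have hd' : Differentiable ℝ (fderiv ℝ f) :=
    differentiable_of_contDiff (hf.fderiv_right (by simp))
  have hD : ∀ v : Vec m, HasFDerivAt (fun y => fderiv ℝ f y v)
      ((fderiv ℝ (fderiv ℝ f) x).flip v) x := by
    intro v
    simpa using (hd' x).hasFDerivAt.clm_apply (hasFDerivAt_const v x)
  have hs : IsSymmSndFDerivAt ℝ f x :=
    hf.contDiffAt.isSymmSndFDerivAt (by simpa using two_le_infty)
  have h1 : dirac f = fun y => ∑ j, clMul m (vec (basisVec j)) (fderiv ℝ f y (basisVec j)) := by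
    funext y
    exact dirac_eq_sum_fderiv (hd y)
  have h2 : HasFDerivAt (dirac f) (∑ j, (clMul m (vec (basisVec j))).comp
      ((fderiv ℝ (fderiv ℝ f) x).flip (basisVec j))) x := by
    rw [h1]
    exact HasFDerivAt.fun_sum fun j _ => (clMul m _).hasFDerivAt.comp x (hD _)
  rw [dirac_eq_sum_fderiv h2.differentiableAt, h2.fderiv]
  have h3 : ∀ v : Vec m, lineDeriv ℝ (fun y => lineDeriv ℝ f y v) x v
      = fderiv ℝ (fderiv ℝ f) x v v := by
    intro v
    rw [funext fun y => (hd y).lineDeriv_eq_fderiv (v := v),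
      (hD v).differentiableAt.lineDeriv_eq_fderiv, (hD v).fderiv, ContinuousLinearMap.flip_apply]
  simp only [h3, sum_apply, ContinuousLinearMap.comp_apply, clMul_apply,
    ContinuousLinearMap.flip_apply, Finset.mul_sum]
  exact sum_sum_basisVec_mul (fun i j => fderiv ℝ (fderiv ℝ f) x (basisVec i) (basisVec j))
    fun i j => hs.eq _ _

theorem contDiff_Dplus {f : Vec m → Cl m} (hf : ContDiff ℝ ∞ f) : ContDiff ℝ ∞ (Dplus f) :=
  ((contDiff_vec_mul hf).const_smul (2 : ℝ)).sub (contDiff_dirac hf)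

/-- The free constant `c` absorbs the sign, so the identity can be iterated. -/
theorem dirac_gauss_smul (c : ℝ) {f : Vec m → Cl m} (hf : ContDiff ℝ ∞ f) :
    dirac (fun x => (c * Real.exp (-‖x‖ ^ 2)) • f x)
      = fun x => (-c * Real.exp (-‖x‖ ^ 2)) • Dplus f x := by
  funext x
  have h : HasDerivAt (fun s : ℝ => c * Real.exp (-s))
      (c * (Real.exp (-‖x‖ ^ 2) * (-1))) (‖x‖ ^ 2) :=
    ((hasDerivAt_id (‖x‖ ^ 2)).neg.exp).const_mul c
  rw [dirac_radial_smul h (differentiable_of_contDiff hf x), Dplus, smul_sub, smul_smul]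
  module

/-- Conjugating the Dirac operator by the Gaussian gives `-D₊`. -/
theorem iterate_dirac_gauss_smul (n : ℕ) (c : ℝ) {f : Vec m → Cl m} (hf : ContDiff ℝ ∞ f) :
    dirac^[n] (fun x => (c * Real.exp (-‖x‖ ^ 2)) • f x)
      = fun x => ((-1) ^ n * c * Real.exp (-‖x‖ ^ 2)) • Dplus^[n] f x := by
  induction n generalizing c f with
  | zero => simp
  | succ n ih =>
    rw [Function.iterate_succ_apply, dirac_gauss_smul c hf, ih (-c) (contDiff_Dplus hf)]
    simp only [Function.iterate_succ_apply, pow_succ]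
    funext x
    congr 2
    ring

theorem IsHomogeneousPolynomial.contDiff {k : ℕ} {P : Vec m → Cl m}
    (hP : IsHomogeneousPolynomial k P) : ContDiff ℝ ∞ P := by
  obtain ⟨c, hc⟩ := hP
  rw [funext hc]
  exact ContDiff.sum fun a _ => (by fun_prop : ContDiff ℝ ∞ fun x : Vec m => ∏ i, x i ^ a i).smul contDiff_const

theorem IsHomogeneousPolynomial.map_smul {k : ℕ} {P : Vec m → Cl m}
    (hP : IsHomogeneousPolynomial k P) (t : ℝ) (x : Vec m) : P (t • x) = t ^ k • P x := by
  obtain ⟨c, hc⟩ := hP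
  rw [hc, hc, Finset.smul_sum]
  refine Finset.sum_congr rfl fun a ha => ?_
  have ha' : ∑ i, a i = k := (Finset.mem_piAntidiag.1 ha).1
  simp only [PiLp.smul_apply, smul_eq_mul, mul_pow, Finset.prod_mul_distrib,
    Finset.prod_pow_eq_pow_sum, ha', smul_smul]

/-- Euler's identity. -/
theorem IsHomogeneousPolynomial.fderiv_self {k : ℕ} {P : Vec m → Cl m}
    (hP : IsHomogeneousPolynomial k P) (x : Vec m) : fderiv ℝ P x x = (k : ℝ) • P x := by
  have h1 : HasDerivAt (fun t : ℝ => P (t • x)) (fderiv ℝ P x x) 1 := by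
    have h0 : HasDerivAt (fun t : ℝ => t • x) x 1 := by
      simpa using (hasDerivAt_id (1 : ℝ)).smul_const x
    have h := (differentiable_of_contDiff hP.contDiff ((1 : ℝ) • x)).hasFDerivAt.comp_hasDerivAt
      (1 : ℝ) h0
    simpa using! h
  have h2 : HasDerivAt (fun t : ℝ => t ^ k • P x) ((k : ℝ) • P x) 1 := by
    simpa using (hasDerivAt_pow k (1 : ℝ)).smul_const (P x)
  simp only [hP.map_smul] at h1
  exact h1.unique h2

end Dirac

/-! ### Axial functions -/

section Axial

variable {m : ℕ}

/-- The function `(Re A(x₀, |x|²) + x Re B(x₀, |x|²)) P(x)`. -/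
def axial (P : Vec m → Cl m) (A B : ℂ × ℂ → ℂ) (p : ℝ × Vec m) : Cl m :=
  (A (p.1, (‖p.2‖ ^ 2 : ℝ))).re • P p.2 + (B (p.1, (‖p.2‖ ^ 2 : ℝ))).re • (vec p.2 * P p.2)

variable {P : Vec m → Cl m} {A B : ℂ × ℂ → ℂ}

theorem contDiff_re_comp (hA : ContDiff ℂ ∞ A) :
    ContDiff ℝ ∞ fun p : ℝ × Vec m => (A (p.1, (‖p.2‖ ^ 2 : ℝ))).re := by
  have h1 : ContDiff ℝ ∞ fun p : ℝ × Vec m => ((p.1 : ℂ), ((‖p.2‖ ^ 2 : ℝ) : ℂ)) :=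
    (Complex.ofRealCLM.contDiff.comp contDiff_fst).prodMk
      (Complex.ofRealCLM.contDiff.comp ((contDiff_norm_sq ℝ).comp contDiff_snd))
  exact Complex.reCLM.contDiff.comp ((hA.restrict_scalars ℝ).comp h1)

theorem contDiff_axial (hP : ContDiff ℝ ∞ P) (hA : ContDiff ℂ ∞ A) (hB : ContDiff ℂ ∞ B) :
    ContDiff ℝ ∞ (axial P A B) :=
  ((contDiff_re_comp hA).smul (hP.comp contDiff_snd)).add
    ((contDiff_re_comp hB).smul ((contDiff_vec_mul hP).comp contDiff_snd))

theorem pd₀_axial (hA : ContDiff ℂ ∞ A) (hB : ContDiff ℂ ∞ B) :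
    pd₀ (axial P A B) = axial P (cd₁ A) (cd₁ B) := by
  funext p
  obtain ⟨t, x⟩ := p
  have hl : ∀ {C : ℂ × ℂ → ℂ}, ContDiff ℂ ∞ C →
      HasDerivAt (fun s : ℝ => (C ((t + s : ℝ), (‖x‖ ^ 2 : ℝ))).re)
        (cd₁ C (t, (‖x‖ ^ 2 : ℝ))).re 0 := by
    intro C hC
    have h := (hasDerivAt_fst hC t (‖x‖ ^ 2 : ℝ)).real_of_complex
    have h' : HasDerivAt (fun s : ℝ => (C ((s : ℝ), (‖x‖ ^ 2 : ℝ))).re)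
        (cd₁ C (t, (‖x‖ ^ 2 : ℝ))).re (t + 0) := by rwa [add_zero]
    exact h'.comp_const_add t 0
  have h := ((hl hA).smul_const (P x)).add ((hl hB).smul_const (vec x * P x))
  rw [pd₀, lineDeriv]
  refine Eq.trans ?_ h.deriv
  congr 1
  funext s
  simp [axial]

theorem pd_eq_lineDeriv (j : Fin m) (F : ℝ × Vec m → Cl m) (t : ℝ) (x : Vec m) :
    pd j F (t, x) = lineDeriv ℝ (fun y => F (t, y)) x (basisVec j) := by
  simp [pd, lineDeriv]

theorem cauchyRiemann_eq (F : ℝ × Vec m → Cl m) (t : ℝ) (x : Vec m) :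
    cauchyRiemann F (t, x) = pd₀ F (t, x) + dirac (fun y => F (t, y)) x := by
  simp only [cauchyRiemann, pd_eq_lineDeriv, dirac]

theorem laplace_eq {F : ℝ × Vec m → Cl m} (hF : ContDiff ℝ ∞ F) (t : ℝ) (x : Vec m) :
    laplace F (t, x) = pd₀ (pd₀ F) (t, x) - dirac (dirac fun y => F (t, y)) x := by
  have hs : ContDiff ℝ ∞ fun y => F (t, y) := hF.comp (contDiff_const.prodMk contDiff_id)
  rw [dirac_dirac hs]
  simp only [laplace, pd_eq_lineDeriv, sub_neg_eq_add]

/-- At real points the system has real coefficients, hence passes to the real parts used in `axial`.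
-/
theorem re_natCast_mul_add (N : ℕ) (s : ℝ) (b c : ℂ) :
    ((2 * (N : ℂ) + 1) * b + 2 * (s : ℂ) * c).re = (2 * N + 1) * b.re + 2 * s * c.re := by
  have h : (2 * (N : ℂ) + 1) * b + 2 * (s : ℂ) * c
      = ((2 * N + 1 : ℝ) : ℂ) * b + ((2 * s : ℝ) : ℂ) * c := by push_cast; rfl
  rw [h, Complex.add_re, Complex.re_ofReal_mul, Complex.re_ofReal_mul]

theorem vec_mul_vec_mul (x : Vec m) (a : Cl m) : vec x * (vec x * a) = -(‖x‖ ^ 2 • a) := by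
  rw [← mul_assoc, vec_mul_self, Algebra.algebraMap_eq_smul_one, smul_mul_assoc, one_mul, neg_smul]

variable {k N : ℕ}

/-- The radial product rule gives `∂_x (A P) = 2 ∂ₜA x P`. For `B x P` one uses `x² = -t` and `∂_x
(x P) = -(m + 2k) P`, which is where Euler's identity and `m + 2k = 2N + 1` enter. -/
theorem dirac_axial (hP : IsHomogeneousPolynomial k P) (hD : ∀ x, dirac P x = 0)
    (hN : m + 2 * k = 2 * N + 1) (hA : ContDiff ℂ ∞ A) (hB : ContDiff ℂ ∞ B) (t : ℝ) :
    dirac (fun x => axial P A B (t, x)) = fun x =>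
      axial P (fun p => -((2 * N + 1) * B p + 2 * p.2 * cd₂ B p)) (fun p => 2 * cd₂ A p) (t, x) := by
  funext x
  have hPd := differentiable_of_contDiff hP.contDiff x
  have hQd := differentiable_of_contDiff (contDiff_vec_mul hP.contDiff) x
  have hdA := (hasDerivAt_snd hA t (‖x‖ ^ 2 : ℝ)).real_of_complex
  have hdB := (hasDerivAt_snd hB t (‖x‖ ^ 2 : ℝ)).real_of_complex
  have hsm : ∀ {C : ℂ × ℂ → ℂ}, ContDiff ℂ ∞ C →
      DifferentiableAt ℝ (fun y : Vec m => (C (t, (‖y‖ ^ 2 : ℝ))).re) x := fun hC =>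
    differentiable_of_contDiff
      ((contDiff_re_comp hC).comp (contDiff_const (c := t).prodMk contDiff_id)) x
  have hN' : (m : ℝ) + 2 * k = 2 * N + 1 := by exact_mod_cast hN
  have hfA : DifferentiableAt ℝ (fun y => (A (t, (‖y‖ ^ 2 : ℝ))).re • P y) x := (hsm hA).smul hPd
  have hfB : DifferentiableAt ℝ (fun y => (B (t, (‖y‖ ^ 2 : ℝ))).re • (vec y * P y)) x :=
    (hsm hB).smul hQd
  simp only [axial]
  rw [dirac_add hfA hfB, dirac_radial_smul hdA hPd,
    dirac_radial_smul hdB hQd, hD, dirac_vec_mul hPd, hD, hP.fderiv_self, vec_mul_vec_mul,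
    mul_zero, Complex.neg_re, re_natCast_mul_add, ← hN']
  simp only [Complex.mul_re, Complex.re_ofNat, Complex.im_ofNat]
  module

theorem dirac_axial_of_isVekuaPair (hP : IsHomogeneousPolynomial k P) (hD : ∀ x, dirac P x = 0)
    (hN : m + 2 * k = 2 * N + 1) (h : IsVekuaPair N A B) (t : ℝ) :
    dirac (fun x => axial P A B (t, x)) = fun x =>
      axial P (fun p => -1 * cd₁ A p) (fun p => -1 * cd₁ B p) (t, x) := by
  rw [dirac_axial hP hD hN h.contDiff_left h.contDiff_right]
  simp only [h.cd₁_left, h.cd₁_right]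
  funext x
  simp [axial]

theorem isMonogenicExt_axial (hP : IsHomogeneousPolynomial k P) (hD : ∀ x, dirac P x = 0)
    (hN : m + 2 * k = 2 * N + 1) (h : IsVekuaPair N A B) : IsMonogenicExt (axial P A B) := by
  refine ⟨(contDiff_axial hP.contDiff h.contDiff_left h.contDiff_right).of_le
    (by exact_mod_cast le_top), ?_⟩
  rintro ⟨t, x⟩
  rw [cauchyRiemann_eq, pd₀_axial h.contDiff_left h.contDiff_right,
    dirac_axial_of_isVekuaPair hP hD hN h]
  simp only [axial, neg_one_mul, Complex.neg_re]
  module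

theorem iterate_dirac_axial (hP : IsHomogeneousPolynomial k P) (hD : ∀ x, dirac P x = 0)
    (hN : m + 2 * k = 2 * N + 1) (h : IsVekuaPair N A B) (t : ℝ) (n : ℕ) :
    dirac^[n] (fun x => axial P A B (t, x)) = fun x =>
      axial P (fun p => (-1) ^ n * cd₁^[n] A p) (fun p => (-1) ^ n * cd₁^[n] B p) (t, x) := by
  induction n generalizing A B with
  | zero => simp
  | succ n ih =>
    have hi : ∀ {C : ℂ × ℂ → ℂ}, ContDiff ℂ ∞ C →
        cd₁^[n] (fun p => -1 * C p) = fun p => -1 * cd₁^[n] C p := by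
      intro C hC
      clear ih
      induction n with
      | zero => rfl
      | succ n ih =>
        rw [Function.iterate_succ_apply', ih, cd₁_const_mul (contDiff_iterate_cd₁ hC n),
          Function.iterate_succ_apply']
    rw [Function.iterate_succ_apply, dirac_axial_of_isVekuaPair hP hD hN h,
      ih (h.cd₁_pair.const_mul (-1)), hi (contDiff_cd₁ h.contDiff_left),
      hi (contDiff_cd₁ h.contDiff_right)]
    simp only [Function.iterate_succ_apply, pow_succ, mul_assoc]

/-- The Cauchy–Kowalevski series of an axial monogenic function converges to that function. -/
theorem hasSum_ckTerm_axial (hP : IsHomogeneousPolynomial k P) (hD : ∀ x, dirac P x = 0)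
    (hN : m + 2 * k = 2 * N + 1) (h : IsVekuaPair N A B) (p : ℝ × Vec m) :
    HasSum (ckTerm (fun x => axial P A B (0, x)) p) (axial P A B p) := by
  obtain ⟨t, x⟩ := p
  have hA := (Complex.reCLM.hasSum (hasSum_iterate_cd₁ h.contDiff_left t
    (‖x‖ ^ 2 : ℝ))).smul_const (P x)
  have hB := (Complex.reCLM.hasSum (hasSum_iterate_cd₁ h.contDiff_right t
    (‖x‖ ^ 2 : ℝ))).smul_const (vec x * P x)
  refine (hA.add hB).congr_fun fun n => ?_
  have hre : ∀ c : ℂ, ((n ! : ℂ)⁻¹ * (t : ℂ) ^ n * c).re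
      = (-t) ^ n / (n ! : ℝ) * ((-1) ^ n * c).re := by
    intro c
    have e1 : (n ! : ℂ)⁻¹ * (t : ℂ) ^ n * c = (((n ! : ℝ)⁻¹ * t ^ n : ℝ) : ℂ) * c := by
      push_cast; rfl
    have e2 : (-1) ^ n * c = (((-1) ^ n : ℝ) : ℂ) * c := by push_cast; rfl
    rw [e1, e2, Complex.re_ofReal_mul, Complex.re_ofReal_mul, neg_pow t]
    have e3 : ((-1 : ℝ)) ^ n * (-1) ^ n = 1 := by rw [← mul_pow]; simp
    linear_combination (-((n ! : ℝ)⁻¹ * t ^ n * c.re)) * e3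
  have hit := congrFun (iterate_dirac_axial hP hD hN h 0 n) x
  simp only [ckTerm, hit]
  simp only [axial, Complex.reCLM_apply, hre, smul_add, smul_smul, Complex.ofReal_zero]

/-- Here `Δ = ∂₀² - ∂_x²`. The system rewrites `∂₀²` as a second-order operator in `t` depending on
`n`, and `dirac_axial` applied twice gives `∂_x²` as the same operator with `N`; the second-order
terms cancel. -/
theorem laplace_axial (hP : IsHomogeneousPolynomial k P) (hD : ∀ x, dirac P x = 0)
    (hN : m + 2 * k = 2 * N + 1) {n : ℕ} (h : IsVekuaPair n A B) :
    laplace (axial P A B) = axial P (fun p => 4 * ((N : ℂ) - n) * cd₂ A p)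
      (fun p => 4 * ((N : ℂ) - n) * cd₂ B p) := by
  funext p
  obtain ⟨t, x⟩ := p
  have hA := h.contDiff_left
  have hB := h.contDiff_right
  have hA₁ : ContDiff ℂ ∞ fun p => -((2 * (N : ℂ) + 1) * B p + 2 * p.2 * cd₂ B p) :=
    ((contDiff_const.mul hB).add ((contDiff_const.mul contDiff_snd).mul (contDiff_cd₂ hB))).neg
  have hB₁ : ContDiff ℂ ∞ fun p => 2 * cd₂ A p := contDiff_const.mul (contDiff_cd₂ hA)
  rw [laplace_eq (contDiff_axial hP.contDiff hA hB), pd₀_axial hA hB,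
    pd₀_axial (contDiff_cd₁ hA) (contDiff_cd₁ hB), dirac_axial hP hD hN hA hB,
    dirac_axial hP hD hN hA₁ hB₁]
  set q : ℂ × ℂ := ((t : ℂ), ((‖x‖ ^ 2 : ℝ) : ℂ)) with hq
  have e1 : cd₂ (fun p => -((2 * (N : ℂ) + 1) * B p + 2 * p.2 * cd₂ B p)) q
      = -((2 * (N : ℂ) + 3) * cd₂ B q + 2 * q.2 * cd₂ (cd₂ B) q) := by
    have h1 := (((hasDerivAt_snd hB q.1 q.2).const_mul (2 * (N : ℂ) + 1)).add
      (((hasDerivAt_id q.2).const_mul 2).mul (hasDerivAt_snd (contDiff_cd₂ hB) q.1 q.2))).neg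
    refine ((hasDerivAt_snd hA₁ q.1 q.2).unique h1).trans ?_
    simp only [id, Prod.mk.eta]
    ring
  have eA : cd₁ (cd₁ A) q = 4 * ((N : ℂ) - n) * cd₂ A q
      + -((2 * (N : ℂ) + 1) * (2 * cd₂ A q) + 2 * q.2 * cd₂ (fun p => 2 * cd₂ A p) q) := by
    rw [h.cd₁_cd₁_left, h.cd₁_right, h.cd₂_cd₁_right, cd₂_const_mul (contDiff_cd₂ hA)]
    ring
  have eB : cd₁ (cd₁ B) q = 4 * ((N : ℂ) - n) * cd₂ B q
      + 2 * cd₂ (fun p => -((2 * (N : ℂ) + 1) * B p + 2 * p.2 * cd₂ B p)) q := by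
    rw [h.cd₁_pair.cd₁_right, h.cd₂_cd₁_left, e1]
    ring
  simp only [axial, ← hq, eA, eB, Complex.add_re]
  rw [show q.2 = ((‖x‖ ^ 2 : ℝ) : ℂ) from rfl]
  module

theorem iterate_laplace_axial (hP : IsHomogeneousPolynomial k P) (hD : ∀ x, dirac P x = 0)
    (hN : m + 2 * k = 2 * N + 1) (h : IsVekuaPair 0 A B) {j : ℕ} (hj : j ≤ N) :
    laplace^[j] (axial P A B) =
      axial P (fun p => 4 ^ j * (N.descFactorial j : ℂ) * cd₂^[j] A p)
        (fun p => 4 ^ j * (N.descFactorial j : ℂ) * cd₂^[j] B p) := by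
  induction j with
  | zero => simp
  | succ j ih =>
    -- The factors `N - j` accumulate to a falling factorial; `j ≤ N` makes the natural subtraction
    -- genuine.
    have hc : ((N.descFactorial (j + 1) : ℕ) : ℂ) = ((N : ℂ) - j) * N.descFactorial j := by
      rw [Nat.descFactorial_succ, Nat.cast_mul, Nat.cast_sub (by omega)]
    rw [Function.iterate_succ_apply', ih (by omega),
      laplace_axial hP hD hN ((h.iterate_cd₂ j).const_mul _),
      cd₂_const_mul (contDiff_iterate_cd₂ h.contDiff_left j),
      cd₂_const_mul (contDiff_iterate_cd₂ h.contDiff_right j), hc]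
    simp only [Function.iterate_succ_apply', pow_succ]
    congr 1 <;> funext p <;> ring

end Axial

/-! ### The closed form -/

section ClosedForm

theorem hasDerivAt_re_sq {C : ℂ × ℂ → ℂ} (hC : ContDiff ℂ ∞ C) (t r : ℝ) :
    HasDerivAt (fun s : ℝ => (C (t, (s ^ 2 : ℝ))).re) ((cd₂ C (t, (r ^ 2 : ℝ))).re * (2 * r)) r := by
  have h1 := (hasDerivAt_snd hC t (r ^ 2 : ℝ)).real_of_complex
  have h2 : HasDerivAt (fun s : ℝ => s ^ 2) (2 * r) r := by simpa using hasDerivAt_pow 2 r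
  exact HasDerivAt.comp (h := fun s : ℝ => s ^ 2) r h1 h2

theorem cosFactor_sq (t r : ℝ) :
    cosFactor (t, (r ^ 2 : ℝ)) = (Real.cos (2 * t * r) : ℝ) := by
  have h : (4 * (t : ℂ) ^ 2 * ((r ^ 2 : ℝ) : ℂ)) = (2 * t * r) ^ 2 := by push_cast; ring
  rw [cosFactor, h, cosSqrt_sq]
  push_cast
  rfl

theorem mul_sincFactor_sq (t r : ℝ) :
    (r : ℂ) * sincFactor (t, (r ^ 2 : ℝ)) = (Real.sin (2 * t * r) : ℝ) := by
  have h : (4 * (t : ℂ) ^ 2 * ((r ^ 2 : ℝ) : ℂ)) = (2 * t * r) ^ 2 := by push_cast; ring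
  have h2 := mul_sincSqrt_sq (2 * t * r)
  rw [sincFactor, h]
  push_cast
  rw [← h2]
  ring

/-- On functions of `r²`, `r⁻¹ ∂_r` is `2 ∂ₜ`. -/
theorem lowerD_cos (j : ℕ) (t : ℝ) {r : ℝ} (hr : r ≠ 0) :
    lowerD j (fun s => Real.cos (2 * t * s)) r
      = 2 ^ j * (cd₂^[j] cosFactor (t, (r ^ 2 : ℝ))).re := by
  induction j generalizing r with
  | zero =>
    have h := congrArg Complex.re (cosFactor_sq t r)
    rw [Complex.ofReal_re] at h
    simpa [lowerD] using h.symm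
  | succ j ih =>
    -- The formula holds only off `0`, but equality near `r` is enough to differentiate it.
    have h1 : (lowerD j fun s => Real.cos (2 * t * s)) =ᶠ[𝓝 r]
        fun s => 2 ^ j * (cd₂^[j] cosFactor (t, (s ^ 2 : ℝ))).re := by
      filter_upwards [isOpen_ne.mem_nhds hr] with s hs using ih hs
    have h2 := (hasDerivAt_re_sq (contDiff_iterate_cd₂ contDiff_cosFactor j) t r).const_mul
      ((2 : ℝ) ^ j)
    have h3 : lowerD (j + 1) (fun s => Real.cos (2 * t * s)) r
        = r⁻¹ * deriv (lowerD j fun s => Real.cos (2 * t * s)) r := by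
      simp only [lowerD, Function.iterate_succ_apply']
    rw [h3, h1.deriv_eq, h2.deriv, Function.iterate_succ_apply']
    field_simp
    ring

/-- On `r f(r²)`, the factor `r⁻¹` cancels `r` and `∂_r` returns `r · 2 f'(r²)`, so the odd shape
persists. -/
theorem upperD_sin (j : ℕ) (t : ℝ) {r : ℝ} (hr : r ≠ 0) :
    upperD j (fun s => Real.sin (2 * t * s)) r
      = r * (2 ^ j * (cd₂^[j] sincFactor (t, (r ^ 2 : ℝ))).re) := by
  induction j generalizing r with
  | zero =>
    have h := congrArg Complex.re (mul_sincFactor_sq t r)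
    rw [Complex.re_ofReal_mul, Complex.ofReal_re] at h
    simpa [upperD] using h.symm
  | succ j ih =>
    have h1 : (fun s => s⁻¹ * upperD j (fun s => Real.sin (2 * t * s)) s) =ᶠ[𝓝 r]
        fun s => 2 ^ j * (cd₂^[j] sincFactor (t, (s ^ 2 : ℝ))).re := by
      filter_upwards [isOpen_ne.mem_nhds hr] with s hs
      rw [ih hs, inv_mul_cancel_left₀ hs]
    have h2 := (hasDerivAt_re_sq (contDiff_iterate_cd₂ contDiff_sincFactor j) t r).const_mul
      ((2 : ℝ) ^ j)
    have h3 : upperD (j + 1) (fun s => Real.sin (2 * t * s)) r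
        = deriv (fun s => s⁻¹ * upperD j (fun s => Real.sin (2 * t * s)) s) r := by
      simp only [upperD, Function.iterate_succ_apply']
    rw [h3, h1.deriv_eq, h2.deriv, Function.iterate_succ_apply']
    ring

theorem neg_two_zpow_mul (j : ℕ) (a : ℝ) : (-2 : ℝ) ^ (-(j : ℤ)) * (2 ^ j * a) = (-1) ^ j * a := by
  rw [zpow_neg, zpow_natCast, neg_pow, mul_inv, ← inv_pow, inv_neg, inv_one]
  field_simp

theorem cosPart_eq (N : ℕ) (t : ℝ) {r : ℝ} (hr : r ≠ 0) :
    cosPart N t r = (∑ j ∈ Finset.range (N + 1), (N.choose j : ℂ) * (-1) ^ j *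
      cd₂^[j] cosFactor (t, (r ^ 2 : ℝ))).re := by
  rw [cosPart, Complex.re_sum]
  refine Finset.sum_congr rfl fun j _ => ?_
  have e : (N.choose j : ℂ) * (-1) ^ j = (((N.choose j : ℝ) * (-1) ^ j : ℝ) : ℂ) := by push_cast; rfl
  rw [lowerD_cos j t hr, e, Complex.re_ofReal_mul, mul_assoc, neg_two_zpow_mul, mul_assoc]

theorem sinPart_eq (N : ℕ) (t : ℝ) {r : ℝ} (hr : r ≠ 0) :
    sinPart N t r = r * (∑ j ∈ Finset.range (N + 1), (N.choose j : ℂ) * (-1) ^ j *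
      cd₂^[j] sincFactor (t, (r ^ 2 : ℝ))).re := by
  rw [sinPart, Complex.re_sum, Finset.mul_sum]
  refine Finset.sum_congr rfl fun j _ => ?_
  have e : (N.choose j : ℂ) * (-1) ^ j = (((N.choose j : ℝ) * (-1) ^ j : ℝ) : ℂ) := by push_cast; rfl
  rw [upperD_sin j t hr, e, Complex.re_ofReal_mul, mul_left_comm r, mul_assoc (N.choose j : ℝ),
    neg_two_zpow_mul]
  ring

variable {m : ℕ} {P : Vec m → Cl m}

/-- The function `(-1)^N ∂ₛ^N [u + x v / r] P(x)`, where `s = r²` and `u + i v = exp (z²)`. -/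
def gaussAxial (N : ℕ) (P : Vec m → Cl m) : ℝ × Vec m → Cl m :=
  axial P (fun p => (-1) ^ N * cd₂^[N] gaussRe p) (fun p => (-1) ^ N * cd₂^[N] gaussIm p)

theorem isVekuaPair_iterate_gauss (N : ℕ) :
    IsVekuaPair N (fun p => (-1) ^ N * cd₂^[N] gaussRe p)
      (fun p => (-1) ^ N * cd₂^[N] gaussIm p) :=
  (isVekuaPair_gauss.iterate_cd₂ N).const_mul _

/-- At `x₀ = 0` the pair is `(exp (-t), 0)`, and the sign from `∂ₜ^N` cancels the prefactor
`(-1)^N`. -/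
theorem gaussAxial_zero (N : ℕ) (P : Vec m → Cl m) (x : Vec m) :
    gaussAxial N P (0, x) = Real.exp (-‖x‖ ^ 2) • P x := by
  have h1 : ∀ w : ℂ, gaussRe (0, w) = Complex.exp (0 - w) := by
    simp [gaussRe, cosFactor, cosSqrt_zero]
  have h2 : ∀ w : ℂ, gaussIm (0, w) = 0 := by simp [gaussIm, sincFactor]
  have h3 : ((-1 : ℂ)) ^ N * (-1) ^ N = 1 := by rw [← mul_pow]; simp
  have h4 := congrFun (iteratedDeriv_comp_const_sub N Complex.exp 0) ((‖x‖ ^ 2 : ℝ) : ℂ)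
  simp only [iteratedDeriv_eq_iterate, Complex.iter_deriv_exp, smul_eq_mul] at h4
  simp only [gaussAxial, axial, Complex.ofReal_zero, iterate_cd₂_eq_iteratedDeriv contDiff_gaussRe,
    iterate_cd₂_eq_iteratedDeriv contDiff_gaussIm, h1, h2]
  have h5 : iteratedDeriv N (fun _ : ℂ => (0 : ℂ)) ((‖x‖ ^ 2 : ℝ) : ℂ) = 0 := by
    rw [iteratedDeriv_const]; simp
  rw [h5, iteratedDeriv_eq_iterate, h4, ← mul_assoc, h3, one_mul, zero_sub, ← Complex.ofReal_neg,
    ← Complex.ofReal_exp]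
  simp only [mul_zero, Complex.ofReal_re, Complex.zero_re, zero_smul, add_zero]

theorem gaussAxial_eq_closedForm (N : ℕ) (P : Vec m → Cl m) {p : ℝ × Vec m} (hp : p.2 ≠ 0) :
    gaussAxial N P p = closedForm N P p := by
  obtain ⟨t, x⟩ := p
  have hr : ‖x‖ ≠ 0 := norm_ne_zero_iff.2 hp
  have he : Complex.exp ((t : ℂ) ^ 2 - ((‖x‖ ^ 2 : ℝ) : ℂ))
      = (Real.exp (t ^ 2 - ‖x‖ ^ 2) : ℝ) := by push_cast; rfl
  have h1 := iterate_cd₂_exp_mul contDiff_cosFactor N (t, (‖x‖ ^ 2 : ℝ))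
  have h2 := iterate_cd₂_exp_mul contDiff_sincFactor N (t, (‖x‖ ^ 2 : ℝ))
  have h1' := congrArg Complex.re h1
  have h2' := congrArg Complex.re h2
  simp only [he, Complex.re_ofReal_mul, ← cosPart_eq N t hr] at h1' h2'
  change axial P _ _ _ = _
  rw [axial, closedForm]
  refine (congrArg₂ (fun a b : ℝ => a • P x + b • (vec x * P x)) h1' h2').trans ?_
  simp only [sinPart_eq N t hr, omega, vec, map_smul, Algebra.algebraMap_eq_smul_one, smul_smul]
  rw [mul_right_comm, mul_inv_cancel₀ hr, one_mul, add_mul, smul_mul_assoc, smul_mul_assoc,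
    one_mul, smul_add, smul_smul, smul_smul]

/-- Equality holds on the whole space, so the iterated Laplacian in `Ft` acts on a smooth function
even across `x = 0`. -/
theorem fueterBase_exp_sq (P : Vec m → Cl m) :
    fueterBase (fun z => Complex.exp (z ^ 2)) P = axial P gaussRe gaussIm := by
  funext p
  obtain ⟨t, x⟩ := p
  have hz : ((⟨t, ‖x‖⟩ : ℂ)) ^ 2 = ((t ^ 2 - ‖x‖ ^ 2 : ℝ) : ℂ) + (2 * t * ‖x‖ : ℝ) * Complex.I := by
    rw [Complex.mk_eq_add_mul_I]
    push_cast
    linear_combination (‖x‖ : ℂ) ^ 2 * Complex.I_sq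
  have he : Complex.exp ((t : ℂ) ^ 2 - ((‖x‖ ^ 2 : ℝ) : ℂ))
      = (Real.exp (t ^ 2 - ‖x‖ ^ 2) : ℝ) := by push_cast; rfl
  have hzre : ((⟨t, ‖x‖⟩ : ℂ) ^ 2).re = t ^ 2 - ‖x‖ ^ 2 := by
    rw [hz, Complex.add_re, Complex.ofReal_re, Complex.re_ofReal_mul, Complex.I_re, mul_zero,
      add_zero]
  have hzim : ((⟨t, ‖x‖⟩ : ℂ) ^ 2).im = 2 * t * ‖x‖ := by
    rw [hz, Complex.add_im, Complex.ofReal_im, Complex.im_ofReal_mul, Complex.I_im, mul_one,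
      zero_add]
  have hre : (gaussRe (t, (‖x‖ ^ 2 : ℝ))).re = (Complex.exp ((⟨t, ‖x‖⟩ : ℂ) ^ 2)).re := by
    rw [Complex.exp_re, hzre, hzim, gaussRe, cosFactor_sq, he, Complex.re_ofReal_mul,
      Complex.ofReal_re]
  have him : ‖x‖ * (gaussIm (t, (‖x‖ ^ 2 : ℝ))).re = (Complex.exp ((⟨t, ‖x‖⟩ : ℂ) ^ 2)).im := by
    have h := congrArg Complex.re (mul_sincFactor_sq t ‖x‖)
    rw [Complex.re_ofReal_mul, Complex.ofReal_re] at h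
    rw [Complex.exp_im, hzre, hzim, gaussIm, he, Complex.re_ofReal_mul, mul_left_comm, h]
  simp only [fueterBase, axial, hre, ← him]
  -- At the origin `omega 0 = 0` matches the vanishing factor `x` of the axial form.
  rcases eq_or_ne x 0 with rfl | hx
  · simp [omega, Algebra.algebraMap_eq_smul_one]
  · have hr : ‖x‖ ≠ 0 := norm_ne_zero_iff.2 hx
    simp only [omega, vec, map_smul, Algebra.algebraMap_eq_smul_one, smul_smul]
    rw [mul_right_comm, mul_inv_cancel₀ hr, one_mul, add_mul, smul_mul_assoc, smul_mul_assoc,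
      one_mul]

theorem Ft_exp_sq {k : ℕ} (hm : Odd m) (hP : IsHomogeneousPolynomial k P)
    (hD : ∀ x, dirac P x = 0) (p : ℝ × Vec m) :
    gaussAxial (k + (m - 1) / 2) P p =
      ((-2 : ℝ) ^ (k + (m - 1) / 2) * ((2 * k + m - 1)‼ : ℝ))⁻¹ •
        Ft k (fun z => Complex.exp (z ^ 2)) P p := by
  have hN : m + 2 * k = 2 * (k + (m - 1) / 2) + 1 := by
    obtain ⟨l, rfl⟩ := hm
    omega
  have hf : 2 * k + m - 1 = 2 * (k + (m - 1) / 2) := by omega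
  rw [Ft, fueterBase_exp_sq, hf]
  set N := k + (m - 1) / 2
  rw [iterate_laplace_axial hP hD hN isVekuaPair_gauss le_rfl, Nat.doubleFactorial_two_mul,
    Nat.descFactorial_self]
  -- The constants agree because `(-2)^N (2N)!! = (-1)^N 4^N N!`.
  have hc : ∀ c : ℂ, ((-1) ^ N * c).re
      = ((-2 : ℝ) ^ N * ((2 ^ N * N ! : ℕ) : ℝ))⁻¹ * (4 ^ N * (N ! : ℂ) * c).re := by
    intro c
    have e1 : (-1) ^ N * c = (((-1) ^ N : ℝ) : ℂ) * c := by push_cast; rfl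
    have e2 : 4 ^ N * (N ! : ℂ) * c = ((4 ^ N * N ! : ℝ) : ℂ) * c := by push_cast; rfl
    have e3 : (-2 : ℝ) ^ N = (-1) ^ N * 2 ^ N := by rw [← mul_pow]; norm_num
    have e4 : (4 : ℝ) ^ N = 2 ^ N * 2 ^ N := by rw [← mul_pow]; norm_num
    have e5 : ((-1 : ℝ)) ^ N * (-1) ^ N = 1 := by rw [← mul_pow]; simp
    have hne : (N ! : ℝ) ≠ 0 := by positivity
    have hne1 : ((-1 : ℝ)) ^ N ≠ 0 := pow_ne_zero _ (by norm_num)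
    rw [e1, e2, Complex.re_ofReal_mul, Complex.re_ofReal_mul, e3, e4]
    push_cast
    field_simp
    linear_combination c.re * e5
  simp only [gaussAxial, axial, hc, smul_add, smul_smul]

end ClosedForm

end CliffordAnalysis

end

/-! ### Assembly of the theorem -/

open CliffordAnalysis in
theorem mainTheorem1 (m k : ℕ) (hm : Odd m) (P : Vec m → Cl m)
    (hP : IsHomogeneousPolynomial k P) (hPmono : IsMonogenic P)
    (g : Vec m → Cl m) (hg : g = fun x => Real.exp (-‖x‖ ^ 2) • P x) :
    -- the Cauchy–Kowalevski series converges everywhere to a monogenic extension of `g`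
    (∀ p : ℝ × Vec m, Summable (ckTerm g p)) ∧
    IsMonogenicExt (CK g) ∧
    (∀ x : Vec m, CK g (0, x) = g x) ∧
    -- first equality
    (∀ p : ℝ × Vec m, CK g p =
      ((-2 : ℝ) ^ (k + (m - 1) / 2) * ((2 * k + m - 1)‼ : ℝ))⁻¹ •
        Ft k (fun z => Complex.exp (z ^ 2)) P p) ∧
    -- second equality; at `x = 0` the closed form is read as a limit
    (∀ p : ℝ × Vec m, p.2 ≠ 0 → CK g p = closedForm (k + (m - 1) / 2) P p) ∧
    (∀ x₀ : ℝ, Filter.Tendsto (closedForm (k + (m - 1) / 2) P)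
      (𝓝[{p : ℝ × Vec m | p.2 ≠ 0}] (x₀, 0)) (𝓝 (CK g (x₀, 0)))) ∧
    -- generating function of the Clifford–Hermite polynomials
    (∀ p : ℝ × Vec m, HasSum
      (fun n : ℕ => (Real.exp (-‖p.2‖ ^ 2) * (p.1 ^ n / (n ! : ℝ))) • cliffordHermite n P p.2)
      (CK g p)) := by
  have hD := hPmono.2
  have hN : m + 2 * k = 2 * (k + (m - 1) / 2) + 1 := by
    obtain ⟨l, rfl⟩ := hm
    omega
  have hpair := isVekuaPair_iterate_gauss (k + (m - 1) / 2)
  have hg' : g = fun x => gaussAxial (k + (m - 1) / 2) P (0, x) := by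
    rw [hg]
    funext x
    exact (gaussAxial_zero _ P x).symm
  have hsum : ∀ p, HasSum (ckTerm g p) (gaussAxial (k + (m - 1) / 2) P p) := by
    intro p
    rw [hg']
    exact hasSum_ckTerm_axial hP hD hN hpair p
  -- All the claims are now read off `gaussAxial`.
  have hCK : CK g = gaussAxial (k + (m - 1) / 2) P := funext fun p => (hsum p).tsum_eq
  have hmono : IsMonogenicExt (CK g) := by
    rw [hCK]
    exact isMonogenicExt_axial hP hD hN hpair
  refine ⟨fun p => (hsum p).summable, hmono, fun x => by rw [hCK, hg'], fun p => ?_,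
    fun p hp => ?_, fun x₀ => ?_, fun p => ?_⟩
  · rw [hCK, Ft_exp_sq hm hP hD]
  · rw [hCK, gaussAxial_eq_closedForm _ P hp]
  -- The limit on the axis is the continuity of `CK g`, which equals the closed form where `x ≠ 0`.
  · refine (hmono.1.continuous.continuousAt.mono_left nhdsWithin_le_nhds).congr' ?_
    filter_upwards [self_mem_nhdsWithin] with p hp
    rw [hCK, gaussAxial_eq_closedForm _ P hp]
  · rw [hCK]
    refine (hsum p).congr_fun fun n => ?_
    have h := iterate_dirac_gauss_smul n 1 hP.contDiff
    simp only [one_mul, mul_one] at h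
    rw [ckTerm, hg, h, cliffordHermite, smul_smul, neg_pow p.1]
    have e : ((-1 : ℝ)) ^ n * (-1) ^ n = 1 := by rw [← mul_pow]; simp
    congr 1
    linear_combination (-(Real.exp (-‖p.2‖ ^ 2) * (p.1 ^ n / (n ! : ℝ)))) * e
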